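/- Let $W$ be a standard Wiener process and let $\sigma:[0,1]\to(0,\infty)$ be continuous, with $\|\sigma\|_\infty=\sup_{t\in[0,1]}|\sigma(t)|$. For $K\in\mathbb{N}$, $K\ge 1$, and $t\in[0,1]$ put $$V(t)=\int_0^t\sigma^2(u)\,du,\qquad \widehat V(t)=\sum_{k=1}^K\Big|\int_{(k-1)/K}^{k/K}\sigma(u)\,dW(u)\Big|^2\,\mathbb{I}\{k/K\le t\}.$$ Then for every $M\in\mathbb{N}$ there is a constant $c$, depending only on $M$ (in particular not on $\sigma$, $K$, $W$ or the probability space), such that for all such $\sigma$ and all $K\ge 1$ the random variable $\big(\sup_{t\in[0,1]}|\widehat V(t)-V(t)|\big)^{2M}$ is integrable and $$\mathbb{E}\Big[\Big(\sup_{t\in[0,1]}\big|\widehat V(t)-V(t)\big|\Big)^{2M}\Big]\le\frac{c\,\|\sigma\|_\infty^{4M}}{K^M}.$$ -/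

import Mathlib

open MeasureTheory ProbabilityTheory Filter Topology
open scoped NNReal ENNReal

namespace WienerIntegral

/-- Step functions `∑ i, c i • 𝟙_{(s i, t i]}` on the half line, given by finitely many
coefficients indexed by the time intervals `(s, t]` with `0 ≤ s ≤ t`. -/
abbrev StepFunction : Type := {p : ℝ≥0 × ℝ≥0 // p.1 ≤ p.2} →₀ ℝ

/-- The real function `∑ i, c i • 𝟙_{(s i, t i]}` represented by a step function. -/
noncomputable def StepFunction.eval (φ : StepFunction) (u : ℝ) : ℝ :=
  φ.sum fun p c => c * (Set.Ioc (p.1.1 : ℝ) (p.1.2 : ℝ)).indicator (fun _ => (1 : ℝ)) u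

/-- The elementary stochastic integral `∑ i, c i * (W (t i) - W (s i))` of a step function. -/
noncomputable def StepFunction.integral {Ω : Type*} (φ : StepFunction) (W : ℝ≥0 → Ω → ℝ)
    (ω : Ω) : ℝ :=
  φ.sum fun p c => c * (W p.1.2 ω - W p.1.1 ω)

/-- `X` is (a version of) the stochastic integral `∫ g dW` of the deterministic square integrable
function `g`: it is the limit in `L²(P)` of the elementary integrals of step functions that
converge to `g` in `L²`. -/
def IsWienerIntegral {Ω : Type*} [MeasurableSpace Ω] (W : ℝ≥0 → Ω → ℝ) (P : Measure Ω)
    (g : ℝ → ℝ) (X : Ω → ℝ) : Prop :=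
  MemLp X 2 P ∧ ∃ φ : ℕ → StepFunction,
    Tendsto (fun n => eLpNorm (fun u => (φ n).eval u - g u) 2 volume) atTop (𝓝 0) ∧
    Tendsto (fun n => eLpNorm (fun ω => (φ n).integral W ω - X ω) 2 P) atTop (𝓝 0)

open Classical in
/-- The stochastic integral `∫_a^b f dW` of a deterministic function `f`, i.e. the integral of
`f • 𝟙_{(a, b]}`. It is determined up to a null set (`IsWienerIntegral.ae_eq`), and exists for
every `f` that is continuous on `[a, b]` (`isWienerIntegral_wienerIntegral`). -/
noncomputable def wienerIntegral {Ω : Type*} [MeasurableSpace Ω] (W : ℝ≥0 → Ω → ℝ) (P : Measure Ω)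
    (f : ℝ → ℝ) (a b : ℝ≥0) : Ω → ℝ :=
  if h : ∃ X : Ω → ℝ, IsWienerIntegral W P ((Set.Ioc (a : ℝ) (b : ℝ)).indicator f) X
  then h.choose else 0

lemma StepFunction.eval_sub (φ ψ : StepFunction) (u : ℝ) :
    (φ - ψ).eval u = φ.eval u - ψ.eval u := by
  unfold StepFunction.eval
  exact Finsupp.sum_sub_index (fun _ _ _ => sub_mul _ _ _)

lemma StepFunction.integral_sub {Ω : Type*} (φ ψ : StepFunction) (W : ℝ≥0 → Ω → ℝ) (ω : Ω) :
    (φ - ψ).integral W ω = φ.integral W ω - ψ.integral W ω := by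
  unfold StepFunction.integral
  exact Finsupp.sum_sub_index (fun _ _ _ => sub_mul _ _ _)

lemma StepFunction.memLp_eval (φ : StepFunction) : MemLp φ.eval 2 volume := by
  unfold StepFunction.eval Finsupp.sum
  refine memLp_finsetSum _ fun p _ => MemLp.const_mul ?_ _
  exact memLp_indicator_const 2 measurableSet_Ioc 1 (Or.inr (by simp))

lemma StepFunction.memLp_integral {Ω : Type*} [MeasurableSpace Ω] {P : Measure Ω}
    {W : ℝ≥0 → Ω → ℝ} (hW : IsPreBrownianReal W P) (φ : StepFunction) :
    MemLp (φ.integral W) 2 P := by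
  unfold StepFunction.integral Finsupp.sum
  refine memLp_finsetSum _ fun p _ => MemLp.const_mul ?_ _
  exact (hW.isGaussianProcess.hasGaussianLaw_eval _).memLp_two.sub
    (hW.isGaussianProcess.hasGaussianLaw_eval _).memLp_two

lemma integral_increment_mul {Ω : Type*} [MeasurableSpace Ω] {P : Measure Ω}
    {W : ℝ≥0 → Ω → ℝ} (hW : IsPreBrownianReal W P) (p q : {p : ℝ≥0 × ℝ≥0 // p.1 ≤ p.2}) :
    ∫ ω, (W p.1.2 ω - W p.1.1 ω) * (W q.1.2 ω - W q.1.1 ω) ∂P =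
      ∫ u, (Set.Ioc (p.1.1 : ℝ) (p.1.2 : ℝ)).indicator (fun _ => (1 : ℝ)) u *
        (Set.Ioc (q.1.1 : ℝ) (q.1.2 : ℝ)).indicator (fun _ => (1 : ℝ)) u := by
  obtain ⟨⟨s, t⟩, hst : s ≤ t⟩ := p
  obtain ⟨⟨s', t'⟩, hst' : s' ≤ t'⟩ := q
  have hP : IsProbabilityMeasure P := hW.isGaussianProcess.isProbabilityMeasure
  have m (t : ℝ≥0) : MemLp (W t) 2 P := (hW.isGaussianProcess.hasGaussianLaw_eval t).memLp_two
  have h0 (s t : ℝ≥0) : ∫ ω, (W t ω - W s ω) ∂P = 0 := by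
    rw [integral_sub (hW.integrable_eval t) (hW.integrable_eval s), hW.integral_eval,
      hW.integral_eval, sub_zero]
  have h1 : ∫ ω, (W t ω - W s ω) * (W t' ω - W s' ω) ∂P =
      cov[fun ω => W t ω - W s ω, fun ω => W t' ω - W s' ω; P] := by
    simp [covariance, h0]
  simp only
  rw [h1, covariance_fun_sub_fun_sub (m _) (m _) (m _) (m _)]
  simp_rw [hW.covariance_fun_eval]
  have h2 : (fun u : ℝ => (Set.Ioc (s : ℝ) (t : ℝ)).indicator (fun _ => (1 : ℝ)) u *
        (Set.Ioc (s' : ℝ) (t' : ℝ)).indicator (fun _ => (1 : ℝ)) u) =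
      (Set.Ioc (max s s' : ℝ) (min t t' : ℝ)).indicator (fun _ => (1 : ℝ)) := by
    ext u
    rw [← Set.Ioc_inter_Ioc]
    by_cases h : u ∈ Set.Ioc (s : ℝ) t <;> by_cases h' : u ∈ Set.Ioc (s' : ℝ) t' <;>
      simp only [Set.indicator, Set.mem_inter_iff, h, h', and_self, and_true, and_false,
        if_true, if_false, mul_one, mul_zero]
  rw [h2, integral_indicator measurableSet_Ioc]
  simp only [integral_const, MeasurableSet.univ, measureReal_restrict_apply, Set.univ_inter,
    Real.volume_real_Ioc, smul_eq_mul, mul_one, NNReal.coe_min]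
  have e1 : (s : ℝ) ≤ t := hst
  have e2 : (s' : ℝ) ≤ t' := hst'
  grind

/-- Itô isometry for step functions. -/
lemma StepFunction.eLpNorm_integral {Ω : Type*} [MeasurableSpace Ω] {P : Measure Ω}
    {W : ℝ≥0 → Ω → ℝ} (hW : IsPreBrownianReal W P) (φ : StepFunction) :
    eLpNorm (φ.integral W) 2 P = eLpNorm φ.eval 2 volume := by
  have key : ∫ ω, φ.integral W ω ^ 2 ∂P = ∫ u, φ.eval u ^ 2 := by
    have m (t : ℝ≥0) : MemLp (W t) 2 P := (hW.isGaussianProcess.hasGaussianLaw_eval t).memLp_two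
    have m2 (p : {p : ℝ≥0 × ℝ≥0 // p.1 ≤ p.2}) :
        MemLp (fun u => (Set.Ioc (p.1.1 : ℝ) (p.1.2 : ℝ)).indicator (fun _ => (1 : ℝ)) u) 2
          volume := memLp_indicator_const 2 measurableSet_Ioc 1 (Or.inr (by simp))
    simp only [StepFunction.integral, StepFunction.eval, Finsupp.sum, sq, Finset.sum_mul_sum]
    rw [integral_finsetSum, integral_finsetSum]
    · refine Finset.sum_congr rfl fun p _ => ?_
      rw [integral_finsetSum, integral_finsetSum]
      · refine Finset.sum_congr rfl fun q _ => ?_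
        calc _ = ∫ ω, φ p * φ q * ((W p.1.2 ω - W p.1.1 ω) * (W q.1.2 ω - W q.1.1 ω)) ∂P := by
              congr with ω
              ring
          _ = ∫ u, φ p * φ q * ((Set.Ioc (p.1.1 : ℝ) (p.1.2 : ℝ)).indicator (fun _ => (1 : ℝ)) u *
                (Set.Ioc (q.1.1 : ℝ) (q.1.2 : ℝ)).indicator (fun _ => (1 : ℝ)) u) := by
              rw [integral_const_mul, integral_const_mul, integral_increment_mul hW p q]
          _ = _ := by
              congr with u
              ring
      · intro q _
        exact ((m2 p).const_mul _).integrable_mul ((m2 q).const_mul _)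
      · intro q _
        exact (((m _).sub (m _)).const_mul _).integrable_mul (((m _).sub (m _)).const_mul _)
    · intro p _
      refine integrable_finsetSum _ fun q _ => ?_
      exact ((m2 p).const_mul _).integrable_mul ((m2 q).const_mul _)
    · intro p _
      refine integrable_finsetSum _ fun q _ => ?_
      exact (((m _).sub (m _)).const_mul _).integrable_mul (((m _).sub (m _)).const_mul _)
  rw [(φ.memLp_integral hW).eLpNorm_eq_integral_rpow_norm (by simp) (by simp),
    φ.memLp_eval.eLpNorm_eq_integral_rpow_norm (by simp) (by simp)]
  simp [key]

/-- Two versions of the same stochastic integral agree almost surely. -/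
lemma IsWienerIntegral.ae_eq {Ω : Type*} [MeasurableSpace Ω] {P : Measure Ω}
    {W : ℝ≥0 → Ω → ℝ} (hW : IsPreBrownianReal W P) {g : ℝ → ℝ}
    (hg : AEStronglyMeasurable g volume) {X Y : Ω → ℝ}
    (hX : IsWienerIntegral W P g X) (hY : IsWienerIntegral W P g Y) : X =ᵐ[P] Y := by
  obtain ⟨mX, φ, h1, h2⟩ := hX
  obtain ⟨mY, ψ, h3, h4⟩ := hY
  have hbound (n : ℕ) : eLpNorm (X - Y) 2 P ≤
      eLpNorm (fun ω => (φ n).integral W ω - X ω) 2 P +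
      (eLpNorm (fun u => (φ n).eval u - g u) 2 volume +
        eLpNorm (fun u => (ψ n).eval u - g u) 2 volume) +
      eLpNorm (fun ω => (ψ n).integral W ω - Y ω) 2 P := by
    have e : X - Y = -(fun ω => (φ n).integral W ω - X ω) + (φ n - ψ n).integral W +
        (fun ω => (ψ n).integral W ω - Y ω) := by
      ext ω
      simp only [Pi.sub_apply, Pi.add_apply, Pi.neg_apply, StepFunction.integral_sub]
      ring
    have e' : (φ n - ψ n).eval =
        (fun u => (φ n).eval u - g u) - (fun u => (ψ n).eval u - g u) := by
      ext u
      simp only [Pi.sub_apply, StepFunction.eval_sub]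
      ring
    have mφ := ((φ n).memLp_integral hW).aestronglyMeasurable.sub mX.aestronglyMeasurable
    have mψ := ((ψ n).memLp_integral hW).aestronglyMeasurable.sub mY.aestronglyMeasurable
    have mi := ((φ n - ψ n).memLp_integral hW).aestronglyMeasurable
    rw [e]
    refine (eLpNorm_add_le (mφ.neg.add mi) mψ (by simp)).trans ?_
    refine add_le_add ?_ le_rfl
    refine (eLpNorm_add_le mφ.neg mi (by simp)).trans ?_
    rw [eLpNorm_neg, StepFunction.eLpNorm_integral hW, e']
    refine add_le_add le_rfl ?_
    exact eLpNorm_sub_le ((φ n).memLp_eval.aestronglyMeasurable.sub hg)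
      ((ψ n).memLp_eval.aestronglyMeasurable.sub hg) (by simp)
  have hz : eLpNorm (X - Y) 2 P ≤ 0 := by
    have h5 := (h2.add (h1.add h3)).add h4
    rw [add_zero, add_zero, add_zero] at h5
    exact ge_of_tendsto' h5 hbound
  have := (eLpNorm_eq_zero_iff (mX.aestronglyMeasurable.sub mY.aestronglyMeasurable)
    (by simp)).1 (le_antisymm hz zero_le)
  filter_upwards [this] with ω hω
  simpa [sub_eq_zero] using hω

/-- A function which is a limit in `L²` of step functions has a stochastic integral. -/
lemma exists_isWienerIntegral_of_tendsto {Ω : Type*} [MeasurableSpace Ω] {P : Measure Ω}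
    {W : ℝ≥0 → Ω → ℝ} (hW : IsPreBrownianReal W P) {g : ℝ → ℝ}
    (hg : AEStronglyMeasurable g volume) (φ : ℕ → StepFunction)
    (hφ : Tendsto (fun n => eLpNorm (fun u => (φ n).eval u - g u) 2 volume) atTop (𝓝 0)) :
    ∃ X : Ω → ℝ, IsWienerIntegral W P g X := by
  have hF : CauchySeq fun n => ((φ n).memLp_integral hW).toLp := by
    rw [EMetric.cauchySeq_iff]
    intro ε hε
    obtain ⟨N, hN⟩ := (ENNReal.tendsto_atTop_zero.1 hφ) (ε / 3)
      (ENNReal.div_pos hε.ne' (by simp))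
    obtain rfl | hε' := eq_or_ne ε ⊤
    · exact ⟨0, fun m _ n _ => edist_lt_top _ _⟩
    refine ⟨N, fun m hm n hn => ?_⟩
    rw [Lp.edist_toLp_toLp]
    have e : (φ m).integral W - (φ n).integral W = (φ m - φ n).integral W := by
      ext ω
      simp [StepFunction.integral_sub]
    have e' : (φ m - φ n).eval =
        (fun u => (φ m).eval u - g u) - (fun u => (φ n).eval u - g u) := by
      ext u
      simp only [Pi.sub_apply, StepFunction.eval_sub]
      ring
    rw [e, StepFunction.eLpNorm_integral hW, e']
    calc _ ≤ ε / 3 + ε / 3 := (eLpNorm_sub_le ((φ m).memLp_eval.aestronglyMeasurable.sub hg)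
            ((φ n).memLp_eval.aestronglyMeasurable.sub hg) (by simp)).trans
              (add_le_add (hN m hm) (hN n hn))
      _ < ε / 3 + ε / 3 + ε / 3 := by
        refine ENNReal.lt_add_right ?_ (ENNReal.div_pos hε.ne' (by simp)).ne'
        simp [ENNReal.div_eq_top, hε']
      _ = ε := ENNReal.add_thirds ε
  obtain ⟨X, hX⟩ := cauchySeq_tendsto_of_complete hF
  refine ⟨X, Lp.memLp X, φ, hφ, ?_⟩
  rw [tendsto_iff_edist_tendsto_0] at hX
  refine hX.congr fun n => ?_
  rw [Lp.edist_def]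
  refine eLpNorm_congr_ae ?_
  filter_upwards [((φ n).memLp_integral hW).coeFn_toLp] with ω hω
  simp [hω]

/-- A function that is continuous on `[a, b]` is a uniform limit of step functions on `(a, b]`. -/
lemma exists_stepFunction_close {f : ℝ → ℝ} {a b : ℝ≥0} (hab : a ≤ b)
    (hf : ContinuousOn f (Set.Icc (a : ℝ) (b : ℝ))) {ε : ℝ} (hε : 0 < ε) :
    ∃ φ : StepFunction, ∀ u,
      |φ.eval u - (Set.Ioc (a : ℝ) (b : ℝ)).indicator f u| ≤
        (Set.Ioc (a : ℝ) (b : ℝ)).indicator (fun _ => ε) u := by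
  obtain rfl | hlt := hab.eq_or_lt
  · exact ⟨0, fun u => by simp [StepFunction.eval]⟩
  have hlt' : (0 : ℝ) < b - a := sub_pos.2 hlt
  obtain ⟨δ, hδ, hfδ⟩ := Metric.uniformContinuousOn_iff.1
    (isCompact_Icc.uniformContinuousOn_of_continuous hf) ε hε
  obtain ⟨n, hn⟩ := exists_nat_gt ((b - a : ℝ) / δ)
  have hn0 : (0 : ℝ) < n := (div_pos hlt' hδ).trans hn
  have hstep : (b - a : ℝ) / n < δ := by
    rw [div_lt_iff₀ hn0]
    rw [div_lt_iff₀ hδ] at hn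
    linarith
  let t (i : ℕ) : ℝ≥0 := a + (b - a) * (i / n)
  have ht (i : ℕ) : (t i : ℝ) = a + (b - a) * (i / n) := by
    simp [t, NNReal.coe_sub hab]
  have htm : Monotone t := fun i j hij => by
    simp only [t]
    gcongr
  let φ : StepFunction := ∑ i ∈ Finset.range n,
    Finsupp.single ⟨(t i, t (i + 1)), htm i.le_succ⟩ (f (t i))
  have hφ (u : ℝ) : φ.eval u = ∑ i ∈ Finset.range n,
      f (t i) * (Set.Ioc (t i : ℝ) (t (i + 1) : ℝ)).indicator (fun _ => (1 : ℝ)) u := by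
    simp only [φ, StepFunction.eval]
    rw [← Finsupp.sum_finsetSum_index (by simp) (by intros; ring)]
    refine Finset.sum_congr rfl fun i _ => ?_
    rw [Finsupp.sum_single_index (by simp)]
  have t0 : (t 0 : ℝ) = a := by simp [ht]
  have tn : (t n : ℝ) = b := by rw [ht, div_self hn0.ne']; ring
  refine ⟨φ, fun u => ?_⟩
  rw [hφ]
  by_cases hu : u ∈ Set.Ioc (a : ℝ) (b : ℝ)
  · have hex : ∃ i, u ≤ t i := ⟨n, by rw [tn]; exact hu.2⟩
    classical
    have hk : Nat.find hex ≠ 0 := by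
      intro h
      have := Nat.find_spec hex
      rw [h, t0] at this
      exact absurd hu.1 (not_lt.2 this)
    obtain ⟨i, hi⟩ := Nat.exists_eq_succ_of_ne_zero hk
    have hi1 : u ≤ t (i + 1) := by
      have := Nat.find_spec hex
      rwa [hi] at this
    have hi2 : (t i : ℝ) < u := not_le.1 (Nat.find_min hex (by omega))
    have hin : i < n := by
      have : Nat.find hex ≤ n := Nat.find_min' hex (by rw [tn]; exact hu.2)
      omega
    rw [Finset.sum_eq_single i]
    · rw [Set.indicator_of_mem hu, Set.indicator_of_mem hu,
        Set.indicator_of_mem (Set.mem_Ioc.2 ⟨hi2, hi1⟩), mul_one, ← Real.dist_eq]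
      refine (hfδ _ ⟨?_, ?_⟩ _ ⟨hu.1.le, hu.2⟩ ?_).le
      · rw [← t0]
        exact_mod_cast htm i.zero_le
      · exact hi2.le.trans hu.2
      · rw [dist_comm, Real.dist_eq, abs_of_pos (sub_pos.2 hi2)]
        refine lt_of_le_of_lt ?_ hstep
        have : (t (i + 1) : ℝ) - t i = (b - a) / n := by
          rw [ht, ht]
          push_cast
          ring
        linarith
    · intro j _ hj
      rw [Set.indicator_of_notMem, mul_zero]
      rintro ⟨h1, h2⟩
      obtain h | h := lt_or_gt_of_ne hj
      · have : (t (j + 1) : ℝ) ≤ t i := by exact_mod_cast htm h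
        linarith
      · have : (t (i + 1) : ℝ) ≤ t j := by exact_mod_cast htm h
        linarith
    · intro h
      exact absurd (Finset.mem_range.2 hin) h
  · rw [Set.indicator_of_notMem hu, Set.indicator_of_notMem hu, Finset.sum_eq_zero]
    · simp
    · intro i hi
      rw [Set.indicator_of_notMem, mul_zero]
      rintro ⟨h1, h2⟩
      refine hu ⟨lt_of_le_of_lt ?_ h1, h2.trans ?_⟩
      · rw [← t0]
        exact_mod_cast htm i.zero_le
      · rw [← tn]
        exact_mod_cast htm (Nat.succ_le_of_lt (Finset.mem_range.1 hi))

/-- The stochastic integral over `[a, b]` of a function that is continuous on `[a, b]` exists, and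
`wienerIntegral` is a version of it. -/
lemma isWienerIntegral_wienerIntegral {Ω : Type*} [MeasurableSpace Ω] {P : Measure Ω}
    {W : ℝ≥0 → Ω → ℝ} (hW : IsPreBrownianReal W P) {f : ℝ → ℝ} {a b : ℝ≥0} (hab : a ≤ b)
    (hf : ContinuousOn f (Set.Icc (a : ℝ) (b : ℝ))) :
    IsWienerIntegral W P ((Set.Ioc (a : ℝ) (b : ℝ)).indicator f) (wienerIntegral W P f a b) := by
  have hg : AEStronglyMeasurable ((Set.Ioc (a : ℝ) (b : ℝ)).indicator f) volume :=
    (aestronglyMeasurable_indicator_iff measurableSet_Ioc).2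
      ((hf.mono Set.Ioc_subset_Icc_self).aestronglyMeasurable measurableSet_Ioc)
  choose φ hφ using fun n : ℕ =>
    exists_stepFunction_close hab hf (ε := 1 / ((n : ℝ) + 1)) (by positivity)
  have hlim : Tendsto (fun n => eLpNorm (fun u => (φ n).eval u -
      (Set.Ioc (a : ℝ) (b : ℝ)).indicator f u) 2 volume) atTop (𝓝 0) := by
    have hb (n : ℕ) : eLpNorm (fun u => (φ n).eval u -
        (Set.Ioc (a : ℝ) (b : ℝ)).indicator f u) 2 volume ≤
        ENNReal.ofReal (1 / ((n : ℝ) + 1)) * volume (Set.Ioc (a : ℝ) (b : ℝ)) ^ (1 / 2 : ℝ) := by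
      refine (eLpNorm_mono_real (hφ n)).trans ?_
      refine (eLpNorm_indicator_const_le _ _).trans ?_
      rw [Real.enorm_eq_ofReal (by positivity)]
      simp
    refine tendsto_of_tendsto_of_tendsto_of_le_of_le tendsto_const_nhds ?_ (fun _ => zero_le) hb
    have := ENNReal.tendsto_ofReal (tendsto_one_div_add_atTop_nhds_zero_nat (𝕜 := ℝ))
    simpa using ENNReal.Tendsto.mul_const this
      (b := volume (Set.Ioc (a : ℝ) (b : ℝ)) ^ (1 / 2 : ℝ)) (Or.inr (by simp))
  have h := exists_isWienerIntegral_of_tendsto hW hg φ hlim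
  rw [wienerIntegral, dif_pos h]
  exact h.choose_spec

/-- The integrated variance `V(t) = ∫_0^t σ(u)² du`. -/
noncomputable def integratedVariance (σ : ℝ → ℝ) (t : ℝ) : ℝ :=
  ∫ u in (0 : ℝ)..t, σ u ^ 2

/-- The realized quadratic variation
`V̂(t) = ∑_{k=1}^K |∫_{(k-1)/K}^{k/K} σ dW|² 𝟙{k/K ≤ t}` (summed over `j = k - 1`). -/
noncomputable def realizedVariation {Ω : Type*} [MeasurableSpace Ω] (W : ℝ≥0 → Ω → ℝ)
    (P : Measure Ω) (σ : ℝ → ℝ) (K : ℕ) (t : ℝ) (ω : Ω) : ℝ :=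
  ∑ j ∈ Finset.range K,
    |wienerIntegral W P σ ((j : ℝ≥0) / K) (((j : ℝ≥0) + 1) / K) ω| ^ 2 *
      (Set.Iic t).indicator (fun _ => (1 : ℝ)) (((j : ℝ) + 1) / K)

/-- The uniform deviation `sup_{t ∈ [0,1]} |V̂(t) - V(t)|`. -/
noncomputable def uniformDeviation {Ω : Type*} [MeasurableSpace Ω] (W : ℝ≥0 → Ω → ℝ)
    (P : Measure Ω) (σ : ℝ → ℝ) (K : ℕ) (ω : Ω) : ℝ :=
  ⨆ t : Set.Icc (0 : ℝ) 1, |realizedVariation W P σ K t ω - integratedVariance σ t|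

/-- The supremum norm `‖σ‖_∞ = sup_{t ∈ [0,1]} |σ(t)|`. -/
noncomputable def supNorm (σ : ℝ → ℝ) : ℝ := ⨆ t : Set.Icc (0 : ℝ) 1, |σ t|

end WienerIntegral

namespace WienerIntegral

lemma StepFunction.eval_add (φ ψ : StepFunction) (u : ℝ) :
    (φ + ψ).eval u = φ.eval u + ψ.eval u := by
  unfold StepFunction.eval
  exact Finsupp.sum_add_index' (fun _ => zero_mul _) (fun _ _ _ => add_mul _ _ _)

lemma StepFunction.integral_add {Ω : Type*} (φ ψ : StepFunction) (W : ℝ≥0 → Ω → ℝ) (ω : Ω) :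
    (φ + ψ).integral W ω = φ.integral W ω + ψ.integral W ω := by
  unfold StepFunction.integral
  exact Finsupp.sum_add_index' (fun _ => zero_mul _) (fun _ _ _ => add_mul _ _ _)

lemma StepFunction.eval_smul (c : ℝ) (φ : StepFunction) (u : ℝ) :
    (c • φ).eval u = c * φ.eval u := by
  unfold StepFunction.eval
  rw [Finsupp.sum_smul_index (by simp), Finsupp.mul_sum]
  simp [mul_assoc]

lemma StepFunction.integral_smul {Ω : Type*} (c : ℝ) (φ : StepFunction) (W : ℝ≥0 → Ω → ℝ) (ω : Ω) :
    (c • φ).integral W ω = c * φ.integral W ω := by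
  unfold StepFunction.integral
  rw [Finsupp.sum_smul_index (by simp), Finsupp.mul_sum]
  simp [mul_assoc]

lemma toReal_eLpNorm_two_sq {α : Type*} [MeasurableSpace α] {μ : Measure α} {f : α → ℝ}
    (hf : MemLp f 2 μ) : (eLpNorm f 2 μ).toReal ^ 2 = ∫ x, f x ^ 2 ∂μ := by
  rw [hf.eLpNorm_eq_integral_rpow_norm (by simp) (by simp), ENNReal.toReal_ofReal (by positivity)]
  simp only [ENNReal.toReal_ofNat, Real.norm_eq_abs, Real.rpow_ofNat, sq_abs]
  rw [← Real.rpow_mul_natCast (integral_nonneg fun _ => sq_nonneg _)]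
  norm_num

variable {Ω : Type*} [MeasurableSpace Ω] {P : Measure Ω} {W : ℝ≥0 → Ω → ℝ}

lemma IsWienerIntegral.zero : IsWienerIntegral W P (fun _ => 0) (fun _ => 0) := by
  refine ⟨MemLp.zero', fun _ => 0, ?_, ?_⟩
  · simp [StepFunction.eval]
  · simp [StepFunction.integral]

lemma IsWienerIntegral.add (hW : IsPreBrownianReal W P) {f g : ℝ → ℝ}
    (hf : AEStronglyMeasurable f volume) (hg : AEStronglyMeasurable g volume) {X Y : Ω → ℝ}
    (hX : IsWienerIntegral W P f X) (hY : IsWienerIntegral W P g Y) :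
    IsWienerIntegral W P (fun u => f u + g u) (fun ω => X ω + Y ω) := by
  obtain ⟨mX, φ, h1, h2⟩ := hX
  obtain ⟨mY, ψ, h3, h4⟩ := hY
  refine ⟨mX.add mY, fun n => φ n + ψ n, ?_, ?_⟩
  · refine tendsto_of_tendsto_of_tendsto_of_le_of_le tendsto_const_nhds
      (by simpa using h1.add h3) (fun _ => zero_le) fun n => ?_
    refine le_trans (le_of_eq ?_) (eLpNorm_add_le
      ((φ n).memLp_eval.aestronglyMeasurable.sub hf)
      ((ψ n).memLp_eval.aestronglyMeasurable.sub hg) (by simp))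
    congr 1 with u
    simp only [StepFunction.eval_add, Pi.add_apply]
    ring
  · refine tendsto_of_tendsto_of_tendsto_of_le_of_le tendsto_const_nhds
      (by simpa using h2.add h4) (fun _ => zero_le) fun n => ?_
    refine le_trans (le_of_eq ?_) (eLpNorm_add_le
      (((φ n).memLp_integral hW).aestronglyMeasurable.sub mX.aestronglyMeasurable)
      (((ψ n).memLp_integral hW).aestronglyMeasurable.sub mY.aestronglyMeasurable) (by simp))
    congr 1 with ω
    simp only [StepFunction.integral_add, Pi.add_apply]
    ring

lemma IsWienerIntegral.const_mul {g : ℝ → ℝ} {X : Ω → ℝ} (hX : IsWienerIntegral W P g X) (c : ℝ) :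
    IsWienerIntegral W P (fun u => c * g u) (fun ω => c * X ω) := by
  obtain ⟨mX, φ, h1, h2⟩ := hX
  refine ⟨mX.const_mul c, fun n => c • φ n, ?_, ?_⟩
  · have := ENNReal.Tendsto.const_mul h1 (a := ‖c‖ₑ) (Or.inr (by simp))
    rw [mul_zero] at this
    refine this.congr fun n => ?_
    rw [← eLpNorm_const_smul]
    congr 1 with u
    simp only [StepFunction.eval_smul, Pi.smul_apply, smul_eq_mul]
    ring
  · have := ENNReal.Tendsto.const_mul h2 (a := ‖c‖ₑ) (Or.inr (by simp))
    rw [mul_zero] at this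
    refine this.congr fun n => ?_
    rw [← eLpNorm_const_smul]
    congr 1 with ω
    simp only [StepFunction.integral_smul, Pi.smul_apply, smul_eq_mul]
    ring

lemma IsWienerIntegral.sum (hW : IsPreBrownianReal W P) {ι : Type*} (s : Finset ι)
    {g : ι → ℝ → ℝ} (hg : ∀ i, AEStronglyMeasurable (g i) volume) {X : ι → Ω → ℝ}
    (hX : ∀ i, IsWienerIntegral W P (g i) (X i)) :
    IsWienerIntegral W P (fun u => ∑ i ∈ s, g i u) (fun ω => ∑ i ∈ s, X i ω) := by
  classical
  induction s using Finset.induction_on with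
  | empty => simpa using IsWienerIntegral.zero
  | insert a s ha ih =>
    simp only [Finset.sum_insert ha]
    exact (hX a).add hW (hg a) (Finset.aestronglyMeasurable_fun_sum _ fun i _ => hg i) ih

lemma IsWienerIntegral.congr_ae {g : ℝ → ℝ} {X Y : Ω → ℝ} (hX : IsWienerIntegral W P g X)
    (h : X =ᵐ[P] Y) : IsWienerIntegral W P g Y := by
  obtain ⟨mX, φ, h1, h2⟩ := hX
  refine ⟨(memLp_congr_ae h).1 mX, φ, h1, h2.congr fun n => eLpNorm_congr_ae ?_⟩
  filter_upwards [h] with ω hω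
  rw [hω]

lemma StepFunction.integral_eval_zero (hW : IsPreBrownianReal W P) (φ : StepFunction) :
    ∫ ω, φ.integral W ω ∂P = 0 := by
  simp only [StepFunction.integral, Finsupp.sum]
  rw [integral_finsetSum]
  · refine Finset.sum_eq_zero fun p _ => ?_
    rw [integral_const_mul, MeasureTheory.integral_sub (hW.integrable_eval _) (hW.integrable_eval _),
      hW.integral_eval, hW.integral_eval]
    simp
  · exact fun p _ => ((hW.integrable_eval _).sub (hW.integrable_eval _)).const_mul _

lemma StepFunction.hasGaussianLaw_integral (hW : IsPreBrownianReal W P) (φ : StepFunction) :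
    HasGaussianLaw (φ.integral W) P := by
  have h1 : IsGaussianProcess
      (fun (p : {p : ℝ≥0 × ℝ≥0 // p.1 ≤ p.2}) ω => W p.1.2 ω - W p.1.1 ω) P := by
    refine hW.isGaussianProcess.of_isGaussianProcess fun p => ⟨{p.1.1, p.1.2},
      ContinuousLinearMap.proj (R := ℝ) (φ := fun _ => ℝ) ⟨p.1.2, by simp⟩ -
        ContinuousLinearMap.proj (R := ℝ) (φ := fun _ => ℝ) ⟨p.1.1, by simp⟩, fun ω => ?_⟩
    simp
  exact (h1.smul (fun p => φ p)).hasGaussianLaw_fun_sum (I := φ.support)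

/-- The characteristic function of an elementary integral, at `1`. -/
lemma StepFunction.integral_cexp (hW : IsPreBrownianReal W P) (φ : StepFunction) :
    ∫ ω, Complex.exp (φ.integral W ω * Complex.I) ∂P =
      Complex.exp (-((eLpNorm φ.eval 2 volume).toReal ^ 2 / 2 : ℝ)) := by
  have hG := φ.hasGaussianLaw_integral hW
  have h := hG.map_eq_gaussianReal
  have hv : Var[φ.integral W; P] = (eLpNorm φ.eval 2 volume).toReal ^ 2 := by
    rw [variance_of_integral_eq_zero hG.aemeasurable (φ.integral_eval_zero hW),
      ← φ.eLpNorm_integral hW, toReal_eLpNorm_two_sq (φ.memLp_integral hW)]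
  have h2 := charFun_gaussianReal (μ := P[φ.integral W]) (v := Var[φ.integral W; P].toNNReal) 1
  rw [← h, charFun_apply_real, integral_map hG.aemeasurable (by fun_prop),
    φ.integral_eval_zero hW] at h2
  rw [Real.coe_toNNReal _ (variance_nonneg _ _), hv] at h2
  simpa [neg_div] using h2

lemma integrable_cexp_mul_I [IsFiniteMeasure P] {X : Ω → ℝ} (hX : AEMeasurable X P) :
    Integrable (fun ω => Complex.exp (X ω * Complex.I)) P :=
  Integrable.mono' (integrable_const (μ := P) (1 : ℝ))
    (AEMeasurable.aestronglyMeasurable (by fun_prop)) (by simp [Complex.norm_exp_ofReal_mul_I])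

/-- The characteristic function of a Wiener integral, at `1`. -/
lemma IsWienerIntegral.integral_cexp (hW : IsPreBrownianReal W P) {g : ℝ → ℝ}
    (hg : MemLp g 2 volume) {X : Ω → ℝ} (hX : IsWienerIntegral W P g X) :
    ∫ ω, Complex.exp (X ω * Complex.I) ∂P = Complex.exp (-((∫ u, g u ^ 2) / 2 : ℝ)) := by
  have hP : IsProbabilityMeasure P := hW.isGaussianProcess.isProbabilityMeasure
  obtain ⟨mX, φ, h1, h2⟩ := hX
  have mφ n := (φ n).memLp_integral hW
  have e1 : Tendsto (fun n => ∫ ω, Complex.exp ((φ n).integral W ω * Complex.I) ∂P) atTop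
      (𝓝 (∫ ω, Complex.exp (X ω * Complex.I) ∂P)) := by
    refine tendsto_integral_of_L1' _
      (integrable_cexp_mul_I mX.aestronglyMeasurable.aemeasurable).aestronglyMeasurable
      (Eventually.of_forall fun n =>
        integrable_cexp_mul_I (mφ n).aestronglyMeasurable.aemeasurable) ?_
    · refine tendsto_of_tendsto_of_tendsto_of_le_of_le tendsto_const_nhds h2
        (fun _ => zero_le) fun n => ?_
      refine le_trans ?_ (eLpNorm_le_eLpNorm_of_exponent_le (p := 1) (by norm_num)
        ((mφ n).aestronglyMeasurable.sub mX.aestronglyMeasurable))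
      refine eLpNorm_mono fun ω => ?_
      simp only [Pi.sub_apply]
      have := Real.norm_exp_I_mul_ofReal_sub_one_le (x := (φ n).integral W ω - X ω)
      calc _ = ‖Complex.exp (X ω * Complex.I) *
            (Complex.exp (Complex.I * ((φ n).integral W ω - X ω : ℝ)) - 1)‖ := by
            rw [mul_sub, ← Complex.exp_add, mul_one]
            congr 3
            push_cast
            ring
        _ ≤ _ := by
            rw [norm_mul, Complex.norm_exp_ofReal_mul_I, one_mul]
            exact this
  have e2 : Tendsto (fun n => (eLpNorm (φ n).eval 2 volume).toReal) atTop
      (𝓝 (eLpNorm g 2 volume).toReal) := by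
    refine tendsto_iff_dist_tendsto_zero.2 ?_
    have h1' := (ENNReal.tendsto_toReal (by simp)).comp h1
    refine squeeze_zero (fun _ => dist_nonneg) (fun n => ?_) (by simpa using h1')
    have := dist_norm_norm_le ((φ n).memLp_eval.toLp) hg.toLp
    rw [← MemLp.toLp_sub, Lp.norm_toLp, Lp.norm_toLp, Lp.norm_toLp] at this
    exact this
  simp_rw [StepFunction.integral_cexp hW] at e1
  refine tendsto_nhds_unique e1 ?_
  rw [← toReal_eLpNorm_two_sq hg]
  exact ((Complex.continuous_exp.comp (Complex.continuous_ofReal.neg)).tendsto _).comp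
    ((e2.pow 2).div_const 2)

lemma IsWienerIntegral.charFun_map (hW : IsPreBrownianReal W P) {g : ℝ → ℝ}
    (hg : MemLp g 2 volume) {X : Ω → ℝ} (hX : IsWienerIntegral W P g X) (t : ℝ) :
    charFun (P.map X) t = Complex.exp (-((t ^ 2 * ∫ u, g u ^ 2) / 2 : ℝ)) := by
  have := (hX.const_mul t).integral_cexp hW (hg.const_mul t)
  rw [charFun_apply_real, integral_map hX.1.aestronglyMeasurable.aemeasurable (by fun_prop)]
  simp_rw [mul_pow, integral_const_mul] at this
  rw [← this]
  push_cast
  rfl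

lemma IsWienerIntegral.map_eq_gaussianReal (hW : IsPreBrownianReal W P) {g : ℝ → ℝ}
    (hg : MemLp g 2 volume) {X : Ω → ℝ} (hX : IsWienerIntegral W P g X) :
    P.map X = gaussianReal 0 (∫ u, g u ^ 2).toNNReal := by
  have hP : IsProbabilityMeasure P := hW.isGaussianProcess.isProbabilityMeasure
  refine Measure.ext_of_charFun (funext fun t => ?_)
  rw [hX.charFun_map hW hg, charFun_gaussianReal,
    Real.coe_toNNReal _ (integral_nonneg fun _ => sq_nonneg _)]
  congr 1
  push_cast
  ring

/-- Wiener integrals of orthogonal functions are independent. -/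
lemma IsWienerIntegral.iIndepFun (hW : IsPreBrownianReal W P) {ι : Type*} {g : ι → ℝ → ℝ}
    (hg : ∀ i, MemLp (g i) 2 volume) (horth : ∀ i j, i ≠ j → ∫ u, g i u * g j u = 0)
    {X : ι → Ω → ℝ} (hX : ∀ i, IsWienerIntegral W P (g i) (X i)) : iIndepFun X P := by
  have hP : IsProbabilityMeasure P := hW.isGaussianProcess.isProbabilityMeasure
  have mX i := (hX i).1.aestronglyMeasurable.aemeasurable
  rw [iIndepFun_iff_finset]
  intro s
  refine (iIndepFun_iff_charFun_pi (ι := s) (E := fun _ => ℝ) (X := fun i => X i) fun i => mX i).2 fun t => ?_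
  have hgt (i : s) : MemLp (fun u => t i * g i.1 u) 2 volume := (hg i).const_mul (t i)
  have h1 := (IsWienerIntegral.sum hW Finset.univ (fun i => (hgt i).aestronglyMeasurable)
    (fun i => (hX i).const_mul (t i))).integral_cexp hW (memLp_finsetSum _ fun i _ => hgt i)
  have h2 : ∫ u, (∑ i : s, t i * g i.1 u) ^ 2 = ∑ i : s, t i ^ 2 * ∫ u, g i.1 u ^ 2 := by
    simp_rw [sq, Finset.sum_mul_sum]
    have hint (i j : s) : Integrable (fun u => t i * g i.1 u * (t j * g j.1 u)) :=
      (hgt i).integrable_mul (hgt j)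
    rw [integral_finsetSum _ fun i _ => integrable_finsetSum _ fun j _ => hint i j]
    refine Finset.sum_congr rfl fun i _ => ?_
    rw [integral_finsetSum _ fun j _ => hint i j]
    have e (j : s) : ∫ u, t i * g i.1 u * (t j * g j.1 u) =
        t i * t j * ∫ u, g i.1 u * g j.1 u := by
      rw [← integral_const_mul]
      congr with u
      ring
    simp_rw [e]
    refine Finset.sum_eq_single i (fun j _ hj => ?_) (by simp)
    rw [horth i j (fun h => hj (Subtype.ext h).symm), mul_zero]
  rw [h2] at h1
  simp_rw [(hX _).charFun_map hW (hg _)]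
  rw [← Complex.exp_sum, charFun_apply,
    integral_map (by fun_prop) (by fun_prop)]
  refine Eq.trans ?_ (h1.trans ?_)
  · simp [PiLp.inner_apply, mul_comm]
  · congr 1
    push_cast
    rw [Finset.sum_div, ← Finset.sum_neg_distrib]

end WienerIntegral

/-- A pathwise form of Doob's maximal inequality in `L²`. -/
lemma sq_partialSups_add_le {s : ℕ → ℝ} (hs : ∀ n, 0 ≤ s n) (n : ℕ) :
    partialSups s n ^ 2 + 8 * ∑ j ∈ Finset.range n, partialSups s j * (s (j + 1) - s j) ≤
      16 * s n ^ 2 := by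
  have key : partialSups s n ^ 2 - 4 * partialSups s n * s n +
      4 * ∑ j ∈ Finset.range n, partialSups s j * (s (j + 1) - s j) ≤ 0 := by
    induction n with
    | zero => simp; nlinarith [sq_nonneg (s 0)]
    | succ n ih =>
      rw [partialSups_add_one, Finset.sum_range_succ]
      have h1 : s n ≤ partialSups s n := le_partialSups s n
      rcases le_total (s (n + 1)) (partialSups s n) with h | h
      · rw [sup_eq_left.2 h]
        linarith
      · rw [sup_eq_right.2 h]
        nlinarith [hs n, hs (n + 1)]
  nlinarith [sq_nonneg (partialSups s n - 4 * s n)]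

namespace ProbabilityTheory

lemma measurable_prod_iSup_lt {Ω : Type*} (Y : ℕ → Ω → ℝ) {k n : ℕ} (hk : k ≤ n) :
    Measurable[⨆ i ∈ Set.Iio n, MeasurableSpace.comap (Y i) inferInstance]
      (fun ω => ∏ i ∈ Finset.range k, Y i ω) := by
  refine Finset.measurable_fun_prod _ fun i hi => ?_
  have : i ∈ Set.Iio n := (Finset.mem_range.1 hi).trans_le hk
  exact (comap_measurable (Y i)).mono
    (le_iSup₂ (f := fun i (_ : i ∈ Set.Iio n) => MeasurableSpace.comap (Y i) inferInstance) i this)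
    le_rfl

lemma _root_.Measurable.partialSups_apply {α : Type*} {m : MeasurableSpace α} {s : ℕ → α → ℝ}
    {n : ℕ} (hs : ∀ k ≤ n, Measurable (s k)) :
    Measurable (fun ω => partialSups (fun k => s k ω) n) := by
  induction n with
  | zero => simpa using hs 0 le_rfl
  | succ n ih =>
    simp only [partialSups_add_one]
    exact (ih fun k hk => hs k (by omega)).sup (hs _ le_rfl)

variable {Ω : Type*} [MeasurableSpace Ω] {P : Measure Ω}

/-- A random variable that is a function of `Y 0, …, Y (n - 1)` is independent of `Y n`. -/
lemma iIndepFun.indepFun_of_measurable_iSup_lt {Y : ℕ → Ω → ℝ} (hY : iIndepFun Y P)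
    (mY : ∀ i, Measurable (Y i)) {n : ℕ} {U : Ω → ℝ}
    (hU : Measurable[⨆ i ∈ Set.Iio n, MeasurableSpace.comap (Y i) inferInstance] U) :
    IndepFun U (Y n) P := by
  have h := indep_iSup_of_disjoint (S := Set.Iio n) (T := {n}) (fun i => (mY i).comap_le) hY
    (by simp)
  rw [IndepFun_iff_Indep]
  refine indep_of_indep_of_le_left (indep_of_indep_of_le_right h ?_) hU.comap_le
  simp

lemma IndepFun.memLp_two_mul {U V : Ω → ℝ} (h : IndepFun U V P) (hU : MemLp U 2 P)
    (hV : MemLp V 2 P) : MemLp (fun ω => U ω * V ω) 2 P := by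
  refine (memLp_two_iff_integrable_sq (hU.aestronglyMeasurable.mul hV.aestronglyMeasurable)).2 ?_
  simp only [Pi.mul_apply, mul_pow]
  exact (h.comp (measurable_id.pow_const 2) (measurable_id.pow_const 2)).integrable_mul
    hU.integrable_sq hV.integrable_sq

lemma iIndepFun.memLp_two_prod_range [IsProbabilityMeasure P] {Y : ℕ → Ω → ℝ}
    (hY : iIndepFun Y P) (mY : ∀ i, Measurable (Y i)) (hL : ∀ i, MemLp (Y i) 2 P) (n : ℕ) :
    MemLp (fun ω => ∏ i ∈ Finset.range n, Y i ω) 2 P := by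
  induction n with
  | zero => simpa using memLp_const 1
  | succ n ih =>
    simp only [Finset.prod_range_succ]
    exact IndepFun.memLp_two_mul (hY.indepFun_of_measurable_iSup_lt mY
      (measurable_prod_iSup_lt Y le_rfl)) ih (hL n)

lemma iIndepFun.integral_sq_prod_range [IsProbabilityMeasure P] {Y : ℕ → Ω → ℝ}
    (hY : iIndepFun Y P) (mY : ∀ i, Measurable (Y i)) (n : ℕ) :
    ∫ ω, (∏ i ∈ Finset.range n, Y i ω) ^ 2 ∂P = ∏ i ∈ Finset.range n, ∫ ω, Y i ω ^ 2 ∂P := by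
  induction n with
  | zero => simp
  | succ n ih =>
    simp only [Finset.prod_range_succ, mul_pow]
    rw [← ih]
    have h := (hY.indepFun_of_measurable_iSup_lt mY (measurable_prod_iSup_lt Y (le_refl n))).comp
      (measurable_id.pow_const 2) (measurable_id.pow_const 2)
    have mp : Measurable fun ω => ∏ i ∈ Finset.range n, Y i ω :=
      Finset.measurable_fun_prod _ fun i _ => mY i
    exact h.integral_mul_eq_mul_integral
      ((measurable_id.pow_const 2).comp mp).aestronglyMeasurable
      ((measurable_id.pow_const 2).comp (mY n)).aestronglyMeasurable

lemma memLp_two_partialSups {s : ℕ → Ω → ℝ} (hs : ∀ k, MemLp (s k) 2 P) (n : ℕ) :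
    MemLp (fun ω => partialSups (fun k => s k ω) n) 2 P := by
  induction n with
  | zero => simpa using hs 0
  | succ n ih =>
    simp only [partialSups_add_one]
    exact ih.sup (hs (n + 1))

/-- Doob's maximal inequality in `L²` for products of independent nonnegative random variables
whose means are at least one. -/
lemma iIndepFun.integral_sq_partialSups_prod_le [IsProbabilityMeasure P] {Y : ℕ → Ω → ℝ}
    (hY : iIndepFun Y P) (mY : ∀ i, Measurable (Y i)) (hL : ∀ i, MemLp (Y i) 2 P)
    (h0 : ∀ i ω, 0 ≤ Y i ω) (h1 : ∀ i, 1 ≤ ∫ ω, Y i ω ∂P) (n : ℕ) :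
    ∫ ω, partialSups (fun k => ∏ i ∈ Finset.range k, Y i ω) n ^ 2 ∂P ≤
      16 * ∏ i ∈ Finset.range n, ∫ ω, Y i ω ^ 2 ∂P := by
  set s : ℕ → Ω → ℝ := fun k ω => ∏ i ∈ Finset.range k, Y i ω with hs
  have ms k : Measurable (s k) := Finset.measurable_fun_prod _ fun i _ => mY i
  have sL k : MemLp (s k) 2 P := hY.memLp_two_prod_range mY hL k
  have SL k := memLp_two_partialSups sL k
  have s0 k ω : 0 ≤ s k ω := Finset.prod_nonneg fun i _ => h0 i ω
  have S0 k ω : 0 ≤ partialSups (fun k => s k ω) k :=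
    (s0 k ω).trans (le_partialSups (fun k => s k ω) k)
  have hint j : Integrable (fun ω => partialSups (fun k => s k ω) j * (s (j + 1) ω - s j ω)) P :=
    (SL j).integrable_mul ((sL (j + 1)).sub (sL j))
  have hpos j : 0 ≤ ∫ ω, partialSups (fun k => s k ω) j * (s (j + 1) ω - s j ω) ∂P := by
    have e ω : partialSups (fun k => s k ω) j * (s (j + 1) ω - s j ω) =
        (partialSups (fun k => s k ω) j * s j ω) * (Y j ω - 1) := by
      simp only [hs, Finset.prod_range_succ]
      ring
    have hm : Measurable[⨆ i ∈ Set.Iio j, MeasurableSpace.comap (Y i) inferInstance]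
        (fun ω => partialSups (fun k => s k ω) j * s j ω) :=
      (Measurable.partialSups_apply fun k hk => measurable_prod_iSup_lt Y hk).mul
        (measurable_prod_iSup_lt Y le_rfl)
    have hi := (hY.indepFun_of_measurable_iSup_lt mY hm).comp measurable_id
      (measurable_id.sub_const 1)
    simp_rw [e]
    have := hi.integral_fun_mul_eq_mul_integral
      ((Measurable.partialSups_apply fun k _ => ms k).mul (ms j)).aestronglyMeasurable
      ((measurable_id.sub_const 1).comp (mY j)).aestronglyMeasurable
    simp only [Function.comp_def, id] at this
    rw [this]
    refine mul_nonneg (integral_nonneg fun ω => mul_nonneg (S0 j ω) (s0 j ω)) ?_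
    rw [integral_sub ((hL j).integrable (by simp)) (integrable_const _)]
    simpa using h1 j
  rw [← hY.integral_sq_prod_range mY n, ← integral_const_mul]
  have hle : ∫ ω, (partialSups (fun k => s k ω) n ^ 2 +
      8 * ∑ j ∈ Finset.range n, partialSups (fun k => s k ω) j * (s (j + 1) ω - s j ω)) ∂P ≤
      ∫ ω, 16 * s n ω ^ 2 ∂P := by
    refine integral_mono ((SL n).integrable_sq.add ((integrable_finsetSum _
      fun j _ => hint j).const_mul 8)) ((sL n).integrable_sq.const_mul 16) fun ω => ?_
    exact sq_partialSups_add_le (fun k => s0 k ω) n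
  rw [integral_add (SL n).integrable_sq ((integrable_finsetSum _
      fun j _ => hint j).const_mul 8), integral_const_mul,
      integral_finsetSum _ fun j _ => hint j] at hle
  have := Finset.sum_nonneg fun j (_ : j ∈ Finset.range n) => hpos j
  linarith

end ProbabilityTheory
namespace ProbabilityTheory

lemma gaussianPDFReal_mul_exp_sq {v : ℝ≥0} (hv : v ≠ 0) (l x : ℝ) :
    gaussianPDFReal 0 v x * Real.exp (l * (x ^ 2 - v)) =
      (√(2 * Real.pi * v))⁻¹ * Real.exp (-(l * v)) *
        Real.exp (-((1 - 2 * (l * v)) / (2 * v)) * x ^ 2) := by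
  have hv' : (v : ℝ) ≠ 0 := by exact_mod_cast hv
  have e : Real.exp (-(x - 0) ^ 2 / (2 * v)) * Real.exp (l * (x ^ 2 - v)) =
      Real.exp (-(l * v)) * Real.exp (-((1 - 2 * (l * v)) / (2 * v)) * x ^ 2) := by
    rw [← Real.exp_add, ← Real.exp_add]
    congr 1
    field_simp
    ring
  rw [gaussianPDFReal, mul_assoc, e, mul_assoc, mul_assoc]

lemma integrable_exp_sq_gaussianReal {v : ℝ≥0} {l : ℝ} (hl : 2 * (l * v) < 1) :
    Integrable (fun x => Real.exp (l * (x ^ 2 - v))) (gaussianReal 0 v) := by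
  rcases eq_or_ne v 0 with rfl | hv
  · rw [gaussianReal_zero_var]
    exact integrable_dirac (by simp)
  have hv' : (0 : ℝ) < v := by exact_mod_cast pos_iff_ne_zero.2 hv
  rw [gaussianReal_of_var_ne_zero _ hv, integrable_withDensity_iff_integrable_smul'
    (measurable_gaussianPDF _ _) (ae_of_all _ fun _ => gaussianPDF_lt_top)]
  simp only [toReal_gaussianPDF, smul_eq_mul, gaussianPDFReal_mul_exp_sq hv]
  exact (integrable_exp_neg_mul_sq (div_pos (by linarith) (by positivity))).const_mul _

lemma integral_exp_sq_gaussianReal {v : ℝ≥0} {l : ℝ} (hl : 2 * (l * v) < 1) :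
    ∫ x, Real.exp (l * (x ^ 2 - v)) ∂(gaussianReal 0 v) =
      Real.exp (-(l * v)) / √(1 - 2 * (l * v)) := by
  rcases eq_or_ne v 0 with rfl | hv
  · simp [gaussianReal_zero_var]
  have hv' : (0 : ℝ) < v := by exact_mod_cast pos_iff_ne_zero.2 hv
  have h1 : 0 < 1 - 2 * (l * v) := by linarith
  rw [integral_gaussianReal_eq_integral_smul hv]
  simp only [smul_eq_mul, gaussianPDFReal_mul_exp_sq hv]
  rw [integral_const_mul, integral_gaussian]
  have e : Real.pi / ((1 - 2 * (l * v)) / (2 * v)) =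
      (2 * Real.pi * v) / (1 - 2 * (l * v)) := by
    field_simp
  rw [e, Real.sqrt_div (by positivity)]
  have : √(2 * Real.pi * v) ≠ 0 := by positivity
  field_simp

lemma exp_neg_div_sqrt_le {a : ℝ} (ha : |a| ≤ 1 / 4) :
    Real.exp (-a) / √(1 - 2 * a) ≤ Real.exp (4 * a ^ 2) := by
  obtain ⟨h1, h2⟩ := abs_le.1 ha
  have hlog := Real.abs_log_sub_add_sum_range_le (x := 2 * a)
    (by rw [abs_mul]; norm_num; linarith) 1
  have hb : |2 * a| ^ (1 + 1) / (1 - |2 * a|) ≤ 8 * a ^ 2 := by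
    rw [one_add_one_eq_two, sq_abs, abs_mul, abs_two, div_le_iff₀ (by linarith)]
    nlinarith [sq_nonneg a]
  have h3 := (abs_le.1 (hlog.trans hb)).1
  simp only [Finset.range_one, Finset.sum_singleton, zero_add, pow_one, Nat.cast_zero,
    div_one] at h3
  have hp : 0 < 1 - 2 * a := by linarith
  have h4 : Real.exp (-a - 4 * a ^ 2) ≤ √(1 - 2 * a) := by
    refine Real.le_sqrt_of_sq_le ?_
    rw [← Real.exp_nat_mul, ← Real.le_log_iff_exp_le hp]
    push_cast
    linarith
  rw [div_le_iff₀ (Real.sqrt_pos.2 hp)]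
  calc Real.exp (-a) = Real.exp (4 * a ^ 2) * Real.exp (-a - 4 * a ^ 2) := by
        rw [← Real.exp_add]
        ring_nf
    _ ≤ _ := by gcongr

lemma one_le_exp_neg_div_sqrt {a : ℝ} (ha : 2 * a < 1) : 1 ≤ Real.exp (-a) / √(1 - 2 * a) := by
  have hp : 0 < 1 - 2 * a := by linarith
  rw [one_le_div (Real.sqrt_pos.2 hp)]
  refine Real.sqrt_le_iff.2 ⟨(Real.exp_pos _).le, ?_⟩
  rw [← Real.exp_nat_mul]
  have := Real.add_one_le_exp ((2 : ℕ) * -a)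
  push_cast at this ⊢
  linarith

end ProbabilityTheory
namespace ProbabilityTheory

variable {Ω : Type*} [MeasurableSpace Ω] {P : Measure Ω}

/-- An exponential maximal inequality for sums of independent centred squares of Gaussian random
variables. -/
lemma integral_sq_partialSups_exp_le [IsProbabilityMeasure P] {X : ℕ → Ω → ℝ}
    (hX : iIndepFun X P) (mX : ∀ i, Measurable (X i)) {v : ℕ → ℝ≥0}
    (hlaw : ∀ i, P.map (X i) = gaussianReal 0 (v i)) {l : ℝ} (hl : ∀ i, |2 * l * v i| ≤ 1 / 4)
    (n : ℕ) :
    Integrable (fun ω =>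
      partialSups (fun k => Real.exp (l * ∑ i ∈ Finset.range k, (X i ω ^ 2 - v i))) n ^ 2) P ∧
    ∫ ω, partialSups (fun k => Real.exp (l * ∑ i ∈ Finset.range k, (X i ω ^ 2 - v i))) n ^ 2 ∂P ≤
      16 * Real.exp (16 * l ^ 2 * ∑ i ∈ Finset.range n, (v i : ℝ) ^ 2) := by
  set Y : ℕ → Ω → ℝ := fun i ω => Real.exp (l * (X i ω ^ 2 - v i)) with hYdef
  have hprod k ω : Real.exp (l * ∑ i ∈ Finset.range k, (X i ω ^ 2 - v i)) =
      ∏ i ∈ Finset.range k, Y i ω := by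
    rw [Finset.mul_sum, Real.exp_sum]
  have hsq i ω : Y i ω ^ 2 = Real.exp (2 * l * (X i ω ^ 2 - v i)) := by
    rw [hYdef, ← Real.exp_nat_mul]
    push_cast
    ring_nf
  have hl1 i : 2 * (l * v i) < 1 := by linarith [(abs_le.1 (hl i)).2]
  have hl2 i : 2 * (2 * l * v i) < 1 := by linarith [(abs_le.1 (hl i)).2]
  have mexp (r : ℝ) i : Measurable fun x : ℝ => Real.exp (r * (x ^ 2 - v i)) := by fun_prop
  have mY i : Measurable (Y i) := (mexp l i).comp (mX i)
  have hY : iIndepFun Y P := hX.comp _ (mexp l)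
  have hint i : ∫ ω, Y i ω ∂P = Real.exp (-(l * v i)) / √(1 - 2 * (l * v i)) := by
    rw [← integral_exp_sq_gaussianReal (hl1 i), ← hlaw i,
      integral_map (mX i).aemeasurable (mexp l i).aestronglyMeasurable]
  have hint2 i : ∫ ω, Y i ω ^ 2 ∂P =
      Real.exp (-(2 * l * v i)) / √(1 - 2 * (2 * l * v i)) := by
    simp_rw [hsq]
    rw [← integral_exp_sq_gaussianReal (hl2 i), ← hlaw i,
      integral_map (mX i).aemeasurable (mexp (2 * l) i).aestronglyMeasurable]
  have hL i : MemLp (Y i) 2 P := by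
    refine (memLp_two_iff_integrable_sq (mY i).aestronglyMeasurable).2 ?_
    simp_rw [hsq]
    have := integrable_exp_sq_gaussianReal (hl2 i)
    rw [← hlaw i] at this
    exact this.comp_measurable (mX i)
  simp_rw [hprod]
  refine ⟨(memLp_two_partialSups (hY.memLp_two_prod_range mY hL) n).integrable_sq,
    (hY.integral_sq_partialSups_prod_le mY hL (fun i ω => (Real.exp_pos _).le)
      (fun i => ?_) n).trans ?_⟩
  · rw [hint]
    exact one_le_exp_neg_div_sqrt (hl1 i)
  · rw [Finset.mul_sum, Real.exp_sum]
    gcongr with i _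
    rw [hint2]
    refine (exp_neg_div_sqrt_le (hl i)).trans_eq ?_
    ring_nf

/-- Moment bounds for a random variable dominated by the maximum of the partial sums of
independent centred squares of Gaussian random variables. -/
lemma integral_pow_le_of_le_max_sum_sq [IsProbabilityMeasure P] {X : ℕ → Ω → ℝ}
    (hX : iIndepFun X P) (mX : ∀ i, Measurable (X i)) {v : ℕ → ℝ≥0}
    (hlaw : ∀ i, P.map (X i) = gaussianReal 0 (v i)) {m : ℝ} (hm : 0 < m) (hv : ∀ i, v i ≤ m)
    {K : ℕ} (hK : 1 ≤ K) {D : Ω → ℝ} (mD : AEStronglyMeasurable D P) (hD0 : ∀ ω, 0 ≤ D ω)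
    (hD : ∀ᵐ ω ∂P, ∀ b, (∀ n ≤ K, |∑ i ∈ Finset.range n, (X i ω ^ 2 - v i)| ≤ b) → D ω ≤ b + m)
    (M : ℕ) :
    Integrable (fun ω => D ω ^ (2 * M)) P ∧
      ∫ ω, D ω ^ (2 * M) ∂P ≤ 128 * (2 * M).factorial * (64 * (m ^ 2 * K)) ^ M := by
  have hK1 : (1 : ℝ) ≤ K := by exact_mod_cast hK
  have hsK : 1 ≤ √(K : ℝ) := Real.one_le_sqrt.2 hK1
  set l : ℝ := (8 * (m * √K))⁻¹ with hldef
  have hl0 : 0 < l := by positivity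
  have hlm : l * m ≤ 1 / 8 := by
    rw [hldef, inv_mul_le_iff₀ (by positivity)]
    nlinarith
  have hl2 : l ^ 2 * (64 * (m ^ 2 * K)) = 1 := by
    rw [hldef, inv_pow, mul_pow, mul_pow, Real.sq_sqrt (by positivity)]
    field_simp
    norm_num
  have hlv i : l * v i ≤ 1 / 8 := (mul_le_mul_of_nonneg_left (hv i) hl0.le).trans hlm
  have hlv0 i : 0 ≤ l * v i := by positivity
  have hsum : 16 * l ^ 2 * ∑ i ∈ Finset.range K, (v i : ℝ) ^ 2 ≤ 1 / 4 := by
    have : ∑ i ∈ Finset.range K, (v i : ℝ) ^ 2 ≤ K * m ^ 2 := by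
      refine (Finset.sum_le_card_nsmul _ _ (m ^ 2) fun i _ => ?_).trans_eq (by simp)
      exact pow_le_pow_left₀ (v i).2 (hv i) 2
    calc _ ≤ 16 * l ^ 2 * (K * m ^ 2) := by gcongr
      _ = 1 / 4 := by linear_combination hl2 / 4
  have hexp : Real.exp (1 / 4) ≤ 2 := by
    rw [← Real.le_log_iff_exp_le (by norm_num)]
    linarith [Real.log_two_gt_d9]
  set S : ℝ → Ω → ℝ := fun r ω =>
    partialSups (fun k => Real.exp (r * ∑ i ∈ Finset.range k, (X i ω ^ 2 - v i))) K with hS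
  obtain ⟨i1, b1⟩ := integral_sq_partialSups_exp_le hX mX hlaw (l := l) (fun i => by
    rw [abs_le]; constructor <;> linarith [hlv i, hlv0 i]) K
  obtain ⟨i2, b2⟩ := integral_sq_partialSups_exp_le hX mX hlaw (l := -l) (fun i => by
    rw [abs_le]; constructor <;> linarith [hlv i, hlv0 i]) K
  rw [neg_sq] at b2
  have hb : 16 * Real.exp (16 * l ^ 2 * ∑ i ∈ Finset.range K, (v i : ℝ) ^ 2) ≤ 32 := by
    linarith [Real.exp_le_exp.2 hsum]
  have hS1 r ω : 1 ≤ S r ω := by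
    refine le_trans ?_ (le_partialSups_of_le _ (Nat.zero_le K))
    simp
  have hbound : ∀ᵐ ω ∂P, D ω ^ (2 * M) ≤
      (2 * (2 * M).factorial * (64 * (m ^ 2 * K)) ^ M) * (S l ω ^ 2 + S (-l) ω ^ 2) := by
    filter_upwards [hD] with ω hω
    have hB : 0 < S l ω + S (-l) ω := by linarith [hS1 l ω, hS1 (-l) ω]
    have h1 := hω (l⁻¹ * Real.log (S l ω + S (-l) ω)) fun n hn => by
      rw [le_inv_mul_iff₀ hl0, Real.le_log_iff_exp_le hB]
      have e1 : Real.exp (l * ∑ i ∈ Finset.range n, (X i ω ^ 2 - v i)) ≤ S l ω :=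
        le_partialSups_of_le
          (fun k => Real.exp (l * ∑ i ∈ Finset.range k, (X i ω ^ 2 - v i))) hn
      have e2 : Real.exp (-l * ∑ i ∈ Finset.range n, (X i ω ^ 2 - v i)) ≤ S (-l) ω :=
        le_partialSups_of_le
          (fun k => Real.exp (-l * ∑ i ∈ Finset.range k, (X i ω ^ 2 - v i))) hn
      rcases abs_cases (∑ i ∈ Finset.range n, (X i ω ^ 2 - v i)) with h | h
      · rw [h.1]
        linarith [hS1 (-l) ω]
      · rw [h.1, mul_neg, ← neg_mul]
        linarith [hS1 l ω]
    have h2 : l * D ω ≤ Real.log (S l ω + S (-l) ω) + 1 / 4 := by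
      have := mul_le_mul_of_nonneg_left h1 hl0.le
      rw [mul_add, mul_inv_cancel_left₀ hl0.ne'] at this
      linarith
    have h3 : Real.exp (l * D ω) ≤ 2 * (S l ω ^ 2 + S (-l) ω ^ 2) := by
      calc _ ≤ Real.exp (Real.log (S l ω + S (-l) ω) + 1 / 4) := Real.exp_le_exp.2 h2
        _ = (S l ω + S (-l) ω) * Real.exp (1 / 4) := by rw [Real.exp_add, Real.exp_log hB]
        _ ≤ (S l ω ^ 2 + S (-l) ω ^ 2) * 2 := by
          gcongr
          · exact le_self_pow₀ (hS1 _ _) (by simp)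
          · exact le_self_pow₀ (hS1 _ _) (by simp)
        _ = _ := mul_comm _ _
    have h4 := Real.pow_div_factorial_le_exp _ (mul_nonneg hl0.le (hD0 ω)) (2 * M)
    rw [div_le_iff₀ (by positivity)] at h4
    have h5 : D ω ^ (2 * M) = (64 * (m ^ 2 * K)) ^ M * (l * D ω) ^ (2 * M) := by
      rw [pow_mul (l * D ω), mul_pow l, ← mul_pow, ← mul_assoc, mul_comm _ (l ^ 2), hl2, one_mul,
        pow_mul]
    rw [h5]
    calc _ ≤ (64 * (m ^ 2 * K)) ^ M *
          (2 * (S l ω ^ 2 + S (-l) ω ^ 2) * (2 * M).factorial) := by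
            gcongr
            exact h4.trans (by gcongr)
      _ = _ := by ring
  have hint : Integrable (fun ω => (2 * (2 * M).factorial * (64 * (m ^ 2 * K)) ^ M) *
      (S l ω ^ 2 + S (-l) ω ^ 2)) P := (i1.add i2).const_mul _
  have hDint : Integrable (fun ω => D ω ^ (2 * M)) P := by
    refine hint.mono' (mD.pow _) ?_
    filter_upwards [hbound] with ω hω
    rwa [Real.norm_of_nonneg (pow_nonneg (hD0 ω) _)]
  refine ⟨hDint, (integral_mono_ae hDint hint hbound).trans ?_⟩
  rw [integral_const_mul, integral_add i1 i2]
  calc _ ≤ (2 * (2 * M).factorial * (64 * (m ^ 2 * K)) ^ M) * (32 + 32) := by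
        gcongr
        · exact b1.trans hb
        · exact b2.trans hb
    _ = _ := by ring

end ProbabilityTheory
namespace WienerIntegral

lemma lipschitzWith_iSup_abs_sum_sub {ι T : Type*} [Fintype ι] [Nonempty T] {a : ι → T → ℝ}
    (ha : ∀ i t, |a i t| ≤ 1) {b : T → ℝ} {C : ℝ} (hb : ∀ t, |b t| ≤ C) :
    LipschitzWith (Fintype.card ι : ℝ≥0)
      (fun x : ι → ℝ => ⨆ t, |∑ i, x i * a i t - b t|) := by
  have hbdd (x : ι → ℝ) : BddAbove (Set.range fun t => |∑ i, x i * a i t - b t|) := by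
    refine ⟨∑ i, |x i| + C, ?_⟩
    rintro _ ⟨t, rfl⟩
    refine (abs_sub _ _).trans (add_le_add ((Finset.abs_sum_le_sum_abs _ _).trans ?_) (hb t))
    refine Finset.sum_le_sum fun i _ => ?_
    rw [abs_mul]
    exact mul_le_of_le_one_right (abs_nonneg _) (ha i t)
  refine LipschitzWith.of_le_add_mul _ fun x y => ciSup_le fun t => ?_
  have h1 : |∑ i, (x i - y i) * a i t| ≤ Fintype.card ι * dist x y := by
    refine (Finset.abs_sum_le_sum_abs _ _).trans
      ((Finset.sum_le_card_nsmul _ _ (dist x y) fun i _ => ?_).trans_eq (by simp))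
    rw [abs_mul]
    exact (mul_le_of_le_one_right (abs_nonneg _) (ha i t)).trans (dist_le_pi_dist x y i)
  calc |∑ i, x i * a i t - b t|
      = |(∑ i, y i * a i t - b t) + ∑ i, (x i - y i) * a i t| := by
        simp_rw [sub_mul, Finset.sum_sub_distrib]
        congr 1
        ring
    _ ≤ |∑ i, y i * a i t - b t| + |∑ i, (x i - y i) * a i t| := abs_add_le _ _
    _ ≤ _ := add_le_add (le_ciSup (hbdd y) t) h1

variable {Ω : Type*} [MeasurableSpace Ω] {P : Measure Ω} {W : ℝ≥0 → Ω → ℝ}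

lemma wienerIntegral_congr {f g : ℝ → ℝ} {a b : ℝ≥0}
    (h : Set.EqOn f g (Set.Ioc (a : ℝ) (b : ℝ))) :
    wienerIntegral W P f a b = wienerIntegral W P g a b := by
  unfold wienerIntegral
  rw [Set.indicator_congr h]

lemma aemeasurable_uniformDeviation {σ : ℝ → ℝ} {K : ℕ}
    (hX : ∀ j < K, AEMeasurable (wienerIntegral W P σ ((j : ℝ≥0) / K) (((j : ℝ≥0) + 1) / K)) P)
    {C : ℝ} (hC : ∀ t ∈ Set.Icc (0 : ℝ) 1, |integratedVariance σ t| ≤ C) :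
    AEMeasurable (uniformDeviation W P σ K) P := by
  have hG := (lipschitzWith_iSup_abs_sum_sub (ι := Fin K) (T := Set.Icc (0 : ℝ) 1)
    (a := fun j t => (Set.Iic (t : ℝ)).indicator (fun _ => (1 : ℝ)) (((j : ℕ) + 1 : ℝ) / K))
    (fun j t => by
      rw [Set.indicator]
      split_ifs <;> simp)
    (b := fun t => integratedVariance σ t) (fun t => hC t t.2)).continuous.measurable
  have hx : AEMeasurable (fun ω (j : Fin K) =>
      |wienerIntegral W P σ (((j : ℕ) : ℝ≥0) / K) ((((j : ℕ) : ℝ≥0) + 1) / K) ω| ^ 2) P :=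
    aemeasurable_pi_lambda _ fun j => by
      simp only [sq_abs]
      exact (hX j j.2).pow_const 2
  refine (hG.comp_aemeasurable hx).congr (Eventually.of_forall fun ω => ?_)
  simp only [Function.comp_def, uniformDeviation, realizedVariation, Finset.sum_range]

lemma uniformDeviation_nonneg (σ : ℝ → ℝ) (K : ℕ) (ω : Ω) : 0 ≤ uniformDeviation W P σ K ω :=
  Real.iSup_nonneg fun _ => abs_nonneg _

lemma realizedVariation_eq_sum_range_floor (σ : ℝ → ℝ) {K : ℕ} (hK : 1 ≤ K) {t : ℝ}
    (ht : t ∈ Set.Icc (0 : ℝ) 1) (ω : Ω) :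
    realizedVariation W P σ K t ω = ∑ j ∈ Finset.range ⌊K * t⌋₊,
      wienerIntegral W P σ ((j : ℝ≥0) / K) (((j : ℝ≥0) + 1) / K) ω ^ 2 := by
  have hK0 : (0 : ℝ) < K := by exact_mod_cast hK
  have hn : ⌊K * t⌋₊ ≤ K := by
    refine Nat.floor_le_of_le ?_
    exact mul_le_of_le_one_right hK0.le ht.2
  unfold realizedVariation
  rw [← Finset.sum_subset (Finset.range_subset_range.2 hn)]
  · refine Finset.sum_congr rfl fun j hj => ?_
    rw [Set.indicator_of_mem, mul_one, sq_abs]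
    rw [Set.mem_Iic, div_le_iff₀ hK0, mul_comm t]
    have := (Nat.le_floor_iff (mul_nonneg hK0.le ht.1)).1 (Nat.succ_le_of_lt (Finset.mem_range.1 hj))
    exact_mod_cast this
  · intro j _ hj
    rw [Set.indicator_of_notMem, mul_zero]
    rw [Set.mem_Iic, div_le_iff₀ hK0, mul_comm t]
    intro h
    refine hj (Finset.mem_range.2 (Nat.lt_of_succ_le ?_))
    refine (Nat.le_floor_iff (mul_nonneg hK0.le ht.1)).2 ?_
    exact_mod_cast h

lemma uniformDeviation_le {σ f : ℝ → ℝ} (hf : Continuous f) (hσ : Set.EqOn σ f (Set.Icc 0 1))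
    {s : ℝ} (hs : ∀ x, |f x| ≤ s) {K : ℕ} (hK : 1 ≤ K) {b : ℝ} {ω : Ω}
    (h : ∀ n ≤ K, |∑ i ∈ Finset.range n,
      (wienerIntegral W P σ ((i : ℝ≥0) / K) (((i : ℝ≥0) + 1) / K) ω ^ 2 -
        ∫ u in ((i : ℝ) / K)..((i + 1 : ℕ) : ℝ) / K, f u ^ 2)| ≤ b) :
    uniformDeviation W P σ K ω ≤ b + s ^ 2 / K := by
  have hK0 : (0 : ℝ) < K := by exact_mod_cast hK
  have hint (a b : ℝ) : IntervalIntegrable (fun u => f u ^ 2) volume a b :=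
    (hf.pow 2).intervalIntegrable a b
  refine ciSup_le fun ⟨t, ht⟩ => ?_
  have hV : integratedVariance σ t = ∫ u in (0 : ℝ)..t, f u ^ 2 := by
    refine intervalIntegral.integral_congr fun u hu => ?_
    rw [Set.uIcc_of_le ht.1] at hu
    simp only [hσ ⟨hu.1, hu.2.trans ht.2⟩]
  set n := ⌊K * t⌋₊ with hn
  have hnK : n ≤ K := Nat.floor_le_of_le (mul_le_of_le_one_right hK0.le ht.2)
  have hsum := intervalIntegral.sum_integral_adjacent_intervals (μ := volume)
    (f := fun u => f u ^ 2) (a := fun i : ℕ => (i : ℝ) / K) (n := n) fun k _ => hint _ _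
  have h1 := h n hnK
  rw [Finset.sum_sub_distrib, hsum] at h1
  simp only [Nat.cast_zero, zero_div] at h1
  have h2 : |∫ u in ((n : ℝ) / K)..t, f u ^ 2| ≤ s ^ 2 / K := by
    have h3 := intervalIntegral.norm_integral_le_of_norm_le_const (C := s ^ 2)
      (f := fun u => f u ^ 2) (a := (n : ℝ) / K) (b := t) fun u _ => by
        rw [Real.norm_eq_abs, abs_pow]
        exact pow_le_pow_left₀ (abs_nonneg _) (hs u) 2
    refine h3.trans ?_
    rw [div_eq_mul_inv (s ^ 2)]
    gcongr
    have h4 : (n : ℝ) / K ≤ t := by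
      rw [div_le_iff₀ hK0, mul_comm t]
      exact Nat.floor_le (mul_nonneg hK0.le ht.1)
    rw [abs_of_nonneg (sub_nonneg.2 h4), sub_le_iff_le_add, ← one_div, ← add_div,
      le_div_iff₀ hK0, mul_comm t, add_comm]
    exact (Nat.lt_floor_add_one _).le
  simp only
  rw [realizedVariation_eq_sum_range_floor σ hK ht ω, hV, ← hn,
    ← intervalIntegral.integral_add_adjacent_intervals (hint 0 ((n : ℝ) / K)) (hint _ t),
    ← sub_sub]
  exact (abs_sub _ _).trans (add_le_add h1 h2)

lemma moment_uniformDeviation_le [IsProbabilityMeasure P] (hW : IsPreBrownianReal W P)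
    {σ : ℝ → ℝ} (hσ : ContinuousOn σ (Set.Icc 0 1)) (hpos : 0 < supNorm σ) {K : ℕ} (hK : 1 ≤ K)
    (M : ℕ) :
    Integrable (fun ω => uniformDeviation W P σ K ω ^ (2 * M)) P ∧
      ∫ ω, uniformDeviation W P σ K ω ^ (2 * M) ∂P ≤
        128 * (2 * M).factorial * (64 * ((supNorm σ ^ 2 / K) ^ 2 * K)) ^ M := by
  have hK0 : (0 : ℝ) < K := by exact_mod_cast hK
  set f : ℝ → ℝ := Set.IccExtend (zero_le_one' ℝ) ((Set.Icc (0 : ℝ) 1).domRestrict σ) with hfdef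
  have hf : Continuous f := continuous_IccExtend_iff.2 hσ.domRestrict
  have hσf : Set.EqOn σ f (Set.Icc 0 1) := fun x hx => by
    rw [hfdef, Set.IccExtend_of_mem _ _ hx]
    rfl
  have hs x : |f x| ≤ supNorm σ := by
    have hbdd : BddAbove (Set.range fun t : Set.Icc (0 : ℝ) 1 => |σ t|) :=
      (isCompact_range (continuous_abs.comp hσ.domRestrict)).bddAbove
    exact le_ciSup hbdd (Set.projIcc 0 1 zero_le_one x)
  have hs2 x : f x ^ 2 ≤ supNorm σ ^ 2 := by
    rw [← sq_abs]
    exact pow_le_pow_left₀ (abs_nonneg _) (hs x) 2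
  have hab (j : ℕ) : (j : ℝ≥0) / K ≤ ((j : ℝ≥0) + 1) / K := by
    gcongr
    simp
  have hab' (j : ℕ) : (j : ℝ) / K ≤ ((j + 1 : ℕ) : ℝ) / K := by
    gcongr
    simp
  set g : ℕ → ℝ → ℝ := fun j =>
    (Set.Ioc (((j : ℝ≥0) / K : ℝ≥0) : ℝ) ((((j : ℝ≥0) + 1) / K : ℝ≥0) : ℝ)).indicator f with hg
  have hgI j : g j = (Set.Ioc ((j : ℝ) / K) (((j + 1 : ℕ) : ℝ) / K)).indicator f := by
    simp [hg]
  have hgL j : MemLp (g j) 2 volume := by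
    rw [hgI, memLp_indicator_iff_restrict measurableSet_Ioc]
    exact MemLp.of_bound hf.aestronglyMeasurable (supNorm σ) (Eventually.of_forall hs)
  have hgint j : ∫ u, g j u ^ 2 = ∫ u in ((j : ℝ) / K)..((j + 1 : ℕ) : ℝ) / K, f u ^ 2 := by
    rw [intervalIntegral.integral_of_le (hab' j), ← integral_indicator measurableSet_Ioc, hgI]
    congr with u
    by_cases hu : u ∈ Set.Ioc ((j : ℝ) / K) (((j + 1 : ℕ) : ℝ) / K)
    · simp only [Set.indicator_of_mem hu]
    · simp only [Set.indicator_of_notMem hu]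
      simp
  have horth i j (hij : i ≠ j) : ∫ u, g i u * g j u = 0 := by
    have hmono : Monotone fun j : ℕ => (j : ℝ) / K := fun i j hij => by
      simp only
      gcongr
    have hd : Disjoint (Set.Ioc ((i : ℝ) / K) (((i + 1 : ℕ) : ℝ) / K))
        (Set.Ioc ((j : ℝ) / K) (((j + 1 : ℕ) : ℝ) / K)) :=
      hmono.pairwise_disjoint_on_Ioc_succ hij
    refine integral_eq_zero_of_ae (Eventually.of_forall fun u => ?_)
    simp only [hgI, Pi.zero_apply]
    by_cases hu : u ∈ Set.Ioc ((i : ℝ) / K) (((i + 1 : ℕ) : ℝ) / K)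
    · rw [Set.indicator_of_notMem (Set.disjoint_left.1 hd hu), mul_zero]
    · rw [Set.indicator_of_notMem hu, zero_mul]
  have hWI (j : ℕ) : IsWienerIntegral W P (g j)
      (wienerIntegral W P f ((j : ℝ≥0) / K) (((j : ℝ≥0) + 1) / K)) :=
    isWienerIntegral_wienerIntegral hW (hab j) hf.continuousOn
  have hmeas (j : ℕ) := (hWI j).1.aestronglyMeasurable
  set X : ℕ → Ω → ℝ := fun j => (hmeas j).mk _ with hX
  have mX j : Measurable (X j) := (hmeas j).stronglyMeasurable_mk.measurable
  have hXI j : IsWienerIntegral W P (g j) (X j) := (hWI j).congr_ae (hmeas j).ae_eq_mk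
  have hcongr j (hj : j < K) : wienerIntegral W P σ ((j : ℝ≥0) / K) (((j : ℝ≥0) + 1) / K) =
      wienerIntegral W P f ((j : ℝ≥0) / K) (((j : ℝ≥0) + 1) / K) := by
    refine wienerIntegral_congr fun u hu => hσf ⟨(NNReal.coe_nonneg _).trans hu.1.le,
      hu.2.trans ?_⟩
    push_cast
    rw [div_le_one hK0]
    exact_mod_cast hj
  have hv0 j : 0 ≤ ∫ u, g j u ^ 2 := integral_nonneg fun _ => sq_nonneg _
  refine integral_pow_le_of_le_max_sum_sq
    (IsWienerIntegral.iIndepFun hW hgL horth hXI) mX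
    (v := fun j => (∫ u, g j u ^ 2).toNNReal)
    (fun j => (hXI j).map_eq_gaussianReal hW (hgL j)) (by positivity) (fun j => ?_) hK
    (aemeasurable_uniformDeviation (C := supNorm σ ^ 2) (fun j hj => ?_)
      fun t ht => ?_).aestronglyMeasurable (uniformDeviation_nonneg σ K) ?_ M
  · rw [Real.coe_toNNReal _ (hv0 j), hgint]
    refine (intervalIntegral.integral_mono_on (hab' j) ((hf.pow 2).intervalIntegrable _ _)
      (intervalIntegrable_const (c := supNorm σ ^ 2)) fun u _ => hs2 u).trans_eq ?_
    rw [intervalIntegral.integral_const]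
    push_cast
    simp only [smul_eq_mul]
    ring
  · rw [hcongr j hj]
    exact (hmeas j).aemeasurable
  · have h3 := intervalIntegral.norm_integral_le_of_norm_le_const (C := supNorm σ ^ 2)
      (f := fun u => σ u ^ 2) (a := 0) (b := t) fun u hu => by
        rw [Set.uIoc_of_le ht.1] at hu
        rw [hσf ⟨hu.1.le, hu.2.trans ht.2⟩, Real.norm_of_nonneg (sq_nonneg _)]
        exact hs2 u
    refine h3.trans (mul_le_of_le_one_right (sq_nonneg _) ?_)
    rw [sub_zero, abs_of_nonneg ht.1]
    exact ht.2
  · filter_upwards [ae_all_iff.2 fun j => (hmeas j).ae_eq_mk] with ω hω b hb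
    refine uniformDeviation_le hf hσf hs hK fun n hn => (le_of_eq ?_).trans (hb n hn)
    congr 1
    refine Finset.sum_congr rfl fun i hi => ?_
    rw [hcongr i ((Finset.mem_range.1 hi).trans_le hn), hω i, Real.coe_toNNReal _ (hv0 i), hgint]

end WienerIntegral

theorem propositionA1 (M : ℕ) :
    ∃ c : ℝ, ∀ (Ω : Type*) [MeasurableSpace Ω] (P : Measure Ω) [IsProbabilityMeasure P]
      (W : ℝ≥0 → Ω → ℝ), IsBrownianReal W P →
      ∀ σ : ℝ → ℝ, ContinuousOn σ (Set.Icc 0 1) → (∀ t ∈ Set.Icc (0 : ℝ) 1, 0 < σ t) →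
      ∀ K : ℕ, 1 ≤ K →
        Integrable (fun ω => WienerIntegral.uniformDeviation W P σ K ω ^ (2 * M)) P ∧
        ∫ ω, WienerIntegral.uniformDeviation W P σ K ω ^ (2 * M) ∂P ≤
          c * WienerIntegral.supNorm σ ^ (4 * M) / (K : ℝ) ^ M := by
  refine ⟨128 * (2 * M).factorial * 64 ^ M, fun Ω _ P _ W hW σ hσ hpos K hK => ?_⟩
  have hK0 : (0 : ℝ) < K := by exact_mod_cast hK
  have hbdd : BddAbove (Set.range fun t : Set.Icc (0 : ℝ) 1 => |σ t|) :=
    (isCompact_range (continuous_abs.comp hσ.domRestrict)).bddAbove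
  have h0 : 0 < WienerIntegral.supNorm σ :=
    (abs_pos.2 (hpos 0 (by simp)).ne').trans_le (le_ciSup hbdd ⟨0, by simp⟩)
  obtain ⟨h1, h2⟩ :=
    WienerIntegral.moment_uniformDeviation_le hW.toIsPreBrownianReal hσ h0 hK M
  refine ⟨h1, h2.trans_eq ?_⟩
  have e : (WienerIntegral.supNorm σ ^ 2 / K) ^ 2 * K = WienerIntegral.supNorm σ ^ 4 / K := by
    field_simp
  rw [e, mul_pow, div_pow, ← pow_mul]
  ring
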